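/- Throughout, $\log$ is the binary logarithm, $d\ge 1$, and clusters use closed balls: for $X\subseteq\mathbb R^d$, $x\in X$, $\rho\ge 0$ put $C_x(\rho)=X\cap \{y:\|y-x\|\le\rho\}$. A Delone set with parameters $(r,R)$, $0<r\le R$, is a set $X\subseteq\mathbb R^d$ such that $r$ is the largest number for which every open ball of radius $r$ contains at most one point of $X$, and $R$ is the smallest number for which every closed ball of radius $R$ contains at least one point of $X$. $X$ is $\rho$-isometric if for all $x,x'\in X$ some isometry of $\mathbb R^d$ maps $x$ to $x'$ and $C_x(\rho)$ onto $C_{x'}(\rho)$; $X$ is a regular system if for all $x,x'\in X$ some isometry of $\mathbb R^d$ maps $x$ to $x'$ and $X$ onto $X$. For a family $\mathcal X$ of Delone sets in $\mathbb R^d$ with the same parameters $(r,R)$, the regularity radius $\hat\rho_d(\mathcal X)$ is the infimum of the numbers $\rho>0$ such that every $\rho$-isometric $X\in\mathcal X$ is a regular system. For $t>0$, the set of $t$-reachable points of $x\in X$ consists of all $y\in X$ that can be joined to $x$ by a finite chain of points of $X$ with consecutive distances at most $t$. A set is full-dimensional if its affine hull is $\mathbb R^d$. **Theorem.** Fix a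 real number $a\ge 1$. For $d\ge1$ and $0<r\le R$ let $\mathcal X_a=\mathcal X_a(d,r,R)$ be the family of $2R$-isometric Delone sets $X\subseteq\mathbb R^d$ with parameters $(r,R)$ such that for every $x\in X$ the set of $2ar$-reachable points of $x$ is full-dimensional. Then $\hat\rho_d(\mathcal X_a)=O(d^2\log d)\,R$ as $d\to\infty$, where the $O(d^2\log d)$-term depends only on $d$ and $a$; precisely, there is a constant $C>0$ depending only on $a$ such that for all $d\ge 2$ and all $0<r\le R$ $$\hat\rho_d(\mathcal X_a)\le C\,d^2\log(d)\,R .$$ Moreover, for all $d\ge 1$ and $0<r\le R$, $$\hat\rho_d(\mathcal X_a)\le (4+2d^2\log(2da+1))R\quad\text{if } 2dar\le 2R,$$ $$\hat\rho_d(\mathcal X_a)\le 2R(d^2+1)\log(2da+2)\quad\text{if } 2dar>2R .$$ In each of the three cases, if $B$ denotes the right-hand side, then every $B$-isometric $X\in\mathcal X_a$ is a regular system. -/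

import Mathlib

namespace DeloneRegularity

/-- Euclidean `d`-space. -/
abbrev E (d : ℕ) : Type := EuclideanSpace ℝ (Fin d)

/-- Every open ball of radius `r` contains at most one point of `X`. -/
def IsPackingRadius {d : ℕ} (X : Set (E d)) (r : ℝ) : Prop :=
  ∀ y : E d, (X ∩ Metric.ball y r).Subsingleton

/-- Every closed ball of radius `R` contains at least one point of `X`. -/
def IsCoveringRadius {d : ℕ} (X : Set (E d)) (R : ℝ) : Prop :=
  ∀ y : E d, (X ∩ Metric.closedBall y R).Nonempty

/-- `X` is a Delone set with exact parameters `(r, R)`: both are positive, `r ≤ R`, and `r` is the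
largest and `R` the smallest number satisfying the packing, respectively covering, condition. -/
structure IsDelone {d : ℕ} (X : Set (E d)) (r R : ℝ) : Prop where
  pos : 0 < r
  le : r ≤ R
  packing : IsGreatest {s : ℝ | IsPackingRadius X s} r
  covering : IsLeast {s : ℝ | IsCoveringRadius X s} R

/-- The cluster of `X` of radius `ρ` with center `x`. -/
def cluster {d : ℕ} (X : Set (E d)) (x : E d) (ρ : ℝ) : Set (E d) :=
  X ∩ Metric.closedBall x ρ

/-- The `ρ`-clusters of `X` at `x` and `x'` are equivalent: an isometry of the whole space maps
`x` to `x'` and the first cluster onto the second. -/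
def ClusterEquivalent {d : ℕ} (X : Set (E d)) (ρ : ℝ) (x x' : E d) : Prop :=
  ∃ g : E d ≃ᵢ E d, g x = x' ∧ g '' cluster X x ρ = cluster X x' ρ

/-- `X` is `ρ`-isometric: any two of its `ρ`-clusters are equivalent. -/
def IsClusterIsometric {d : ℕ} (X : Set (E d)) (ρ : ℝ) : Prop :=
  ∀ x ∈ X, ∀ x' ∈ X, ClusterEquivalent X ρ x x'

/-- `X` is a regular system: its symmetry group acts transitively on it. -/
def IsRegularSystem {d : ℕ} (X : Set (E d)) : Prop :=
  ∀ x ∈ X, ∀ x' ∈ X, ∃ g : E d ≃ᵢ E d, g x = x' ∧ g '' X = X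

/-- Within the family `F`, being `ρ`-isometric forces regularity. -/
def ForcesRegularity {d : ℕ} (F : Set (Set (E d))) (ρ : ℝ) : Prop :=
  ∀ X ∈ F, IsClusterIsometric X ρ → IsRegularSystem X

/-- The regularity radius of a family `F`: the infimum of all positive `ρ` such that each
`ρ`-isometric member of `F` is a regular system (it is `∞` if there is no such `ρ`). -/
noncomputable def regularityRadius {d : ℕ} (F : Set (Set (E d))) : ENNReal :=
  sInf {s : ENNReal | ∃ ρ : ℝ, 0 < ρ ∧ ForcesRegularity F ρ ∧ s = ENNReal.ofReal ρ}

/-- The points of `X` that are reachable from `x` by a chain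
`x = c 0, c 1, …, c m = y` in `X` with `m ≤ k` steps, each of length at most `t`. -/
def reachableIn {d : ℕ} (X : Set (E d)) (t : ℝ) (x : E d) (k : ℕ) : Set (E d) :=
  {y | ∃ m ≤ k, ∃ c : ℕ → E d, c 0 = x ∧ c m = y ∧ (∀ i ≤ m, c i ∈ X) ∧
    ∀ i < m, dist (c (i + 1)) (c i) ≤ t}

/-- The set of `t`-reachable points of `X` for `x`. -/
def reachable {d : ℕ} (X : Set (E d)) (t : ℝ) (x : E d) : Set (E d) :=
  ⋃ k : ℕ, reachableIn X t x k

/-- A set is full-dimensional if its affine hull is the whole space. -/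
def FullDimensional {d : ℕ} (M : Set (E d)) : Prop :=
  affineSpan ℝ M = ⊤

/-- The family of `2R`-isometric Delone sets in `ℝ^d` with parameters `(r, R)` whose sets of
`2ar`-reachable points are all full-dimensional. -/
def reachableFamily (d : ℕ) (a r R : ℝ) : Set (Set (E d)) :=
  {X | IsDelone X r R ∧ IsClusterIsometric X (2 * R) ∧
    ∀ x ∈ X, FullDimensional (reachable X (2 * a * r) x)}

/-- `B` bounds the regularity radius of `F` from above, and at `B` itself being `B`-isometric
forces regularity within `F`. -/
def RegularityRadiusAtMost {d : ℕ} (F : Set (Set (E d))) (B : ℝ) : Prop :=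
  regularityRadius F ≤ ENNReal.ofReal B ∧ ForcesRegularity F B

end DeloneRegularity

/-! For the stabilizer of `x` in the symmetries of its `ρ`-cluster, the local criterion
`IsDelone.isRegularSystem` says: if it does not shrink from `ρ` to `ρ + 2R` and `X` is `(ρ +
2R)`-isometric, then `X` is regular. Along the radii `2R, 4R, …` each strict shrinking at least
halves the order, so an order below `2 ^ n` at radius `2R` forces a repetition within `n` steps.

The order is bounded by `card_clusterGroup_le`: a symmetry fixing `x` is determined by the images of
`d` cluster points whose differences with `x` span the space. A small full-dimensional cluster is
needed. As `X` is `2R`-isometric, the dimension reached in `k` steps grows with `k` until it is `d`,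
so radius `2dar` suffices if it is at most `2R`; otherwise radius `2R` does. A volume bound on the
cluster then gives order at most `(2da + 1) ^ (d ^ 2)`. The first explicit bound thus holds in both
cases, and the other two are weakenings of it. -/

namespace DeloneRegularity

open Metric Module

variable {d : ℕ} {X : Set (E d)} {r R : ℝ}

/-! ### Packing estimates and clusters -/

theorem IsPackingRadius.two_mul_le_dist (h : IsPackingRadius X r) {x y : E d} (hx : x ∈ X)
    (hy : y ∈ X) (hxy : x ≠ y) : 2 * r ≤ dist x y := by
  by_contra! hlt
  refine hxy (h (midpoint ℝ x y) ⟨hx, ?_⟩ ⟨hy, ?_⟩)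
  · rw [mem_ball, dist_left_midpoint]
    norm_num
    linarith
  · rw [mem_ball, dist_right_midpoint]
    norm_num
    linarith

/-- Volume comparison: the open `r`-balls around the points are disjoint and lie in the ball of
radius `ρ + r`. -/
theorem IsPackingRadius.card_le (h : IsPackingRadius X r) (hr : 0 < r) {x : E d} {ρ : ℝ}
    (hρ : 0 ≤ ρ) (s : Finset (E d)) (hs : (s : Set (E d)) ⊆ cluster X x ρ) :
    (s.card : ℝ) ≤ (ρ / r + 1) ^ d := by
  open MeasureTheory in
  let μ : Measure (E d) := volume
  have hdisj : (s : Set (E d)).PairwiseDisjoint fun y => ball y r := by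
    intro y hy z hz hyz
    apply ball_disjoint_ball
    linarith [h.two_mul_le_dist (hs hy).1 (hs hz).1 hyz]
  have hunion : (⋃ y ∈ s, ball y r) ⊆ ball x (ρ + r) := by
    refine Set.iUnion₂_subset fun y hy => ball_subset_ball' ?_
    have := (hs hy).2
    rw [mem_closedBall] at this
    linarith
  have hμ0 : 0 < μ.real (ball 0 1) := by
    rw [measureReal_def]
    exact ENNReal.toReal_pos (measure_ball_pos μ _ one_pos).ne' measure_ball_lt_top.ne
  have hball (y : E d) {t : ℝ} (ht : 0 < t) : μ.real (ball y t) = t ^ d * μ.real (ball 0 1) := by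
    rw [measureReal_def, Measure.addHaar_ball_of_pos μ y ht, ENNReal.toReal_mul,
      ENNReal.toReal_ofReal (by positivity), finrank_euclideanSpace_fin, measureReal_def]
  have hsum : ∑ y ∈ s, μ.real (ball y r) ≤ μ.real (ball x (ρ + r)) := by
    rw [← measureReal_biUnion_finset hdisj (fun _ _ => measurableSet_ball)
      (fun _ _ => measure_ball_lt_top.ne)]
    exact measureReal_mono hunion measure_ball_lt_top.ne
  rw [Finset.sum_congr rfl fun y _ => hball y hr, hball x (by positivity), Finset.sum_const,
    nsmul_eq_mul, ← mul_assoc] at hsum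
  have hle := le_of_mul_le_mul_right hsum hμ0
  rw [div_add_one hr.ne', div_pow, le_div_iff₀ (by positivity)]
  exact hle

theorem IsPackingRadius.finite_cluster (h : IsPackingRadius X r) (hr : 0 < r) (x : E d)
    (ρ : ℝ) : (cluster X x ρ).Finite := by
  rcases lt_or_ge ρ 0 with hρ | hρ
  · simp [cluster, closedBall_eq_empty.2 hρ]
  by_contra hinf
  obtain ⟨s, hs, hcard⟩ := Set.Infinite.exists_subset_card_eq hinf (⌊(ρ / r + 1) ^ d⌋₊ + 1)
  have := Nat.le_floor (h.card_le hr hρ s hs)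
  omega

theorem IsPackingRadius.ncard_cluster_le (h : IsPackingRadius X r) (hr : 0 < r) (x : E d)
    {ρ : ℝ} (hρ : 0 ≤ ρ) : ((cluster X x ρ).ncard : ℝ) ≤ (ρ / r + 1) ^ d := by
  have hfin := h.finite_cluster hr x ρ
  rw [Set.ncard_eq_toFinset_card _ hfin]
  exact h.card_le hr hρ _ hfin.coe_toFinset.subset

theorem mem_cluster_self {x : E d} (hx : x ∈ X) {ρ : ℝ} (hρ : 0 ≤ ρ) : x ∈ cluster X x ρ :=
  ⟨hx, mem_closedBall_self hρ⟩

theorem cluster_mono (x : E d) {ρ σ : ℝ} (h : ρ ≤ σ) : cluster X x ρ ⊆ cluster X x σ :=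
  Set.inter_subset_inter_right _ (closedBall_subset_closedBall h)

/-- A cluster contained in a larger one is cut out of it by a ball, and isometries preserve balls.
-/
theorem image_cluster_inter_closedBall {g : E d ≃ᵢ E d} {y y' : E d} {σ : ℝ}
    (hg : g '' cluster X y σ = cluster X y' σ) (hy : g y = y') {z : E d} {ρ : ℝ}
    (hz : dist z y + ρ ≤ σ) : g '' cluster X z ρ = cluster X (g z) ρ := by
  have key (w w' : E d) (hw : dist w w' + ρ ≤ σ) :
      cluster X w ρ = cluster X w' σ ∩ closedBall w ρ := by
    have hsub : closedBall w ρ ⊆ closedBall w' σ := closedBall_subset_closedBall' (by linarith)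
    rw [cluster, cluster, Set.inter_assoc, Set.inter_eq_right.2 hsub]
  have hz' : dist (g z) y' + ρ ≤ σ := by rwa [← hy, g.dist_eq]
  rw [key z y hz, key (g z) y' hz', Set.image_inter g.injective, hg, g.image_closedBall]

theorem ClusterEquivalent.mono {ρ σ : ℝ} (h : ρ ≤ σ) {x x' : E d}
    (hx : ClusterEquivalent X σ x x') : ClusterEquivalent X ρ x x' := by
  obtain ⟨g, rfl, hg⟩ := hx
  exact ⟨g, rfl, image_cluster_inter_closedBall hg rfl (by simpa using h)⟩

theorem IsClusterIsometric.mono {ρ σ : ℝ} (h : ρ ≤ σ) (hX : IsClusterIsometric X σ) :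
    IsClusterIsometric X ρ :=
  fun x hx x' hx' => (hX x hx x' hx').mono h

theorem ForcesRegularity.mono {F : Set (Set (E d))} {ρ σ : ℝ} (h : ρ ≤ σ)
    (hF : ForcesRegularity F ρ) : ForcesRegularity F σ :=
  fun X hX hσ => hF X hX (hσ.mono h)

theorem ForcesRegularity.regularityRadiusAtMost {F : Set (Set (E d))} {B : ℝ} (hB : 0 < B)
    (h : ForcesRegularity F B) : RegularityRadiusAtMost F B :=
  ⟨sInf_le ⟨B, hB, h, rfl⟩, h⟩

/-! ### Consequences of the covering radius -/

namespace IsDelone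

theorem covers (hX : IsDelone X r R) : IsCoveringRadius X R := hX.covering.1

theorem packs (hX : IsDelone X r R) : IsPackingRadius X r := hX.packing.1

theorem covering_pos (hX : IsDelone X r R) : 0 < R := hX.pos.trans_le hX.le

/-- From any point of `X`, some point of `X` within distance `2R` lies in the ball of radius `R`
that is obtained by moving a touching ball slightly away in direction `n`. -/
theorem exists_mem_shifted_ball (hX : IsDelone X r R) (z : E d) {n : E d} (hn : ‖n‖ = 1)
    {δ : ℝ} (hδ : 0 < δ) :
    ∃ ε, 0 < ε ∧ ε ≤ δ ∧ ∃ w ∈ X, dist w z ≤ 2 * R ∧ dist w (z + (R + ε) • n) ≤ R := by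
  have hR := hX.covering_pos
  have hfin : {w ∈ cluster X z (3 * R) | 2 * R < dist w z}.Finite :=
    (hX.packs.finite_cluster hX.pos z _).subset (Set.sep_subset _ _)
  -- Only finitely many points lie at distance in `(2R, 3R]` from `z`, so a small `ε` leaves none in
  -- `(2R, 2R + ε]`. This yields the sharp `2R`.
  have hev : ∀ᶠ ε : ℝ in nhdsWithin 0 (Set.Ioi 0),
      ∀ w ∈ {w ∈ cluster X z (3 * R) | 2 * R < dist w z}, 2 * R + ε < dist w z := by
    rw [Filter.eventually_all_finite hfin]
    intro w hw
    have : ∀ᶠ ε : ℝ in nhds 0, ε < dist w z - 2 * R := gt_mem_nhds (by linarith [hw.2])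
    filter_upwards [this.filter_mono nhdsWithin_le_nhds] with ε hε
    linarith
  have hsmall : ∀ᶠ ε : ℝ in nhdsWithin 0 (Set.Ioi 0), ε < min δ R :=
    (gt_mem_nhds (lt_min hδ hR) : ∀ᶠ ε : ℝ in nhds 0, ε < min δ R).filter_mono
      nhdsWithin_le_nhds
  obtain ⟨ε, hε, hεm, hε0⟩ := (hev.and (hsmall.and self_mem_nhdsWithin)).exists
  have hε0 : 0 < ε := hε0
  obtain ⟨hεδ, hεR⟩ := lt_min_iff.1 hεm
  obtain ⟨w, hwX, hw⟩ := hX.covers (z + (R + ε) • n)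
  rw [mem_closedBall] at hw
  have hdist : dist w z ≤ 2 * R + ε := by
    have h1 : dist (z + (R + ε) • n) z = R + ε := by
      rw [dist_eq_norm, add_sub_cancel_left, norm_smul, hn, mul_one, Real.norm_eq_abs,
        abs_of_pos (by linarith)]
    linarith [dist_triangle w (z + (R + ε) • n) z]
  refine ⟨ε, hε0, hεδ.le, w, hwX, ?_, hw⟩
  by_contra! hlt
  have := hε w ⟨⟨hwX, by rw [mem_closedBall]; linarith⟩, hlt⟩
  linarith

/-- If `v` were orthogonal to the cluster, shift a ball of radius `R` along `v`: by Pythagoras every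
cluster point is at distance at least `R + ε` from its center, yet one must lie in it. -/
theorem vectorSpan_cluster (hX : IsDelone X r R) {x : E d} (hx : x ∈ X) :
    vectorSpan ℝ (cluster X x (2 * R)) = ⊤ := by
  have hR := hX.covering_pos
  have hxc := mem_cluster_self hx (by positivity : 0 ≤ 2 * R)
  rw [← Submodule.orthogonal_eq_bot_iff, Submodule.eq_bot_iff]
  intro v hv
  by_contra hv0
  have hv0' : ‖v‖ ≠ 0 := norm_ne_zero_iff.2 hv0
  have hn : ‖(‖v‖⁻¹ • v)‖ = 1 := by rw [norm_smul, norm_inv, norm_norm, inv_mul_cancel₀ hv0']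
  obtain ⟨ε, hε, -, w, hw, hwx, hwn⟩ := hX.exists_mem_shifted_ball x hn one_pos
  have horth : inner ℝ (w - x) v = 0 :=
    (Submodule.mem_orthogonal _ _).1 hv _ (vsub_mem_vectorSpan ℝ (s := cluster X x (2 * R))
      ⟨hw, mem_closedBall.2 hwx⟩ hxc)
  set n := ‖v‖⁻¹ • v with hndef
  have horthn : inner ℝ (w - x) ((R + ε) • n) = 0 := by
    rw [hndef, inner_smul_right, inner_smul_right, horth, mul_zero, mul_zero]
  have hsq : dist w (x + (R + ε) • n) ^ 2 = ‖w - x‖ ^ 2 + (R + ε) ^ 2 := by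
    rw [dist_eq_norm, ← sub_sub, @norm_sub_sq_real, horthn, norm_smul, hn, mul_one,
      Real.norm_eq_abs, sq_abs]
    ring
  have := pow_le_pow_left₀ dist_nonneg hwn 2
  nlinarith [sq_nonneg ‖w - x‖]

/-- Induction along chains with steps of length at most `2R`. -/
theorem chain_induction (hX : IsDelone X r R) {x : E d} (hxX : x ∈ X)
    {P : E d → Prop} (hx : P x)
    (hstep : ∀ y ∈ X, ∀ z ∈ X, dist z y ≤ 2 * R → P y → P z) : ∀ z ∈ X, P z := by
  by_contra! hbad
  obtain ⟨z₀, hz₀, hPz₀⟩ := hbad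
  have hR := hX.covering_pos
  have hfin : {w ∈ cluster X x (dist z₀ x) | ¬ P w}.Finite :=
    (hX.packs.finite_cluster hX.pos x _).subset (Set.sep_subset _ _)
  obtain ⟨z, ⟨⟨hzX, hzb⟩, hPz⟩, hmin⟩ := hfin.exists_minimalFor (fun w => dist w x) _
    ⟨z₀, ⟨hz₀, mem_closedBall.2 le_rfl⟩, hPz₀⟩
  have hxz : x ≠ z := fun h => hPz (h ▸ hx)
  set n : E d := (dist z x)⁻¹ • (x - z) with hn
  have hdpos : 0 < dist z x := dist_pos.2 hxz.symm
  have hn1 : ‖n‖ = 1 := by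
    rw [hn, norm_smul, norm_inv, ← dist_eq_norm, dist_comm x z, Real.norm_of_nonneg hdpos.le,
      inv_mul_cancel₀ hdpos.ne']
  -- Since `z` is a counterexample nearest to `x`, a neighbor strictly closer to `x` satisfies `P`
  -- and passes it on to `z`. The ball shifted towards `x` supplies one.
  suffices ∃ w ∈ X, dist w z ≤ 2 * R ∧ (w = x ∨ dist w x < dist z x) by
    obtain ⟨w, hw, hwz, hwx⟩ := this
    have hPw : P w := by
      rcases hwx with rfl | hwx
      · exact hx
      · by_contra hPw
        have := hmin ⟨⟨hw, mem_closedBall.2 (hwx.le.trans hzb)⟩, hPw⟩ hwx.le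
        exact this.not_gt hwx
    exact hPz (hstep w hw z hzX (by rwa [dist_comm]) hPw)
  rcases le_or_gt (dist z x) (2 * R) with hle | hgt
  · exact ⟨x, hxX, by rwa [dist_comm], Or.inl rfl⟩
  obtain ⟨ε, hε, hεR, w, hw, hwz, hwn⟩ := hX.exists_mem_shifted_ball z hn1 hR
  refine ⟨w, hw, hwz, Or.inr ?_⟩
  have h1 : dist (z + (R + ε) • n) x = dist z x - (R + ε) := by
    have : z + (R + ε) • n - x = (dist z x - (R + ε)) • (-n) := by
      have hxz' : x - z = dist z x • n := by rw [hn, smul_inv_smul₀ hdpos.ne']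
      rw [smul_neg, sub_smul, ← hxz']
      abel
    rw [dist_eq_norm, this, norm_smul, norm_neg, hn1, mul_one, Real.norm_of_nonneg (by linarith)]
  linarith [dist_triangle w (z + (R + ε) • n) x]

end IsDelone

/-! ### Reachable points and growth of dimension -/

theorem mem_reachableIn_self {x : E d} (hx : x ∈ X) (t : ℝ) (k : ℕ) : x ∈ reachableIn X t x k :=
  ⟨0, Nat.zero_le _, fun _ => x, rfl, rfl, fun _ _ => hx, by simp⟩

theorem reachableIn_mono (t : ℝ) (x : E d) {k l : ℕ} (h : k ≤ l) :
    reachableIn X t x k ⊆ reachableIn X t x l :=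
  fun _ ⟨m, hm, hc⟩ => ⟨m, hm.trans h, hc⟩

theorem mem_reachableIn_one {x y : E d} {t : ℝ} (hx : x ∈ X) (hy : y ∈ X) (h : dist y x ≤ t) :
    y ∈ reachableIn X t x 1 := by
  refine ⟨1, le_rfl, fun i => if i = 0 then x else y, by simp, by simp, ?_, ?_⟩
  · intro i _
    dsimp only
    split_ifs <;> assumption
  · intro i hi
    obtain rfl : i = 0 := by omega
    simpa using h

theorem reachableIn_subset_succ {x y : E d} {t : ℝ} (hx : x ∈ X) (h : dist y x ≤ t) (k : ℕ) :
    reachableIn X t y k ⊆ reachableIn X t x (k + 1) := by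
  rintro z ⟨m, hm, c, h0, hz, hcX, hct⟩
  refine ⟨m + 1, by omega, fun i => if i = 0 then x else c (i - 1), by simp, by simp [hz], ?_, ?_⟩
  · intro i hi
    dsimp only
    split_ifs
    · exact hx
    · exact hcX _ (by omega)
  · rintro (_ | i) hi
    · simpa [h0] using h
    · simpa using hct i (by omega)

theorem dist_chain_le {c : ℕ → E d} {t : ℝ} {m : ℕ} (hc : ∀ i < m, dist (c (i + 1)) (c i) ≤ t) :
    ∀ i ≤ m, dist (c i) (c 0) ≤ i * t := by
  intro i
  induction i with
  | zero => simp
  | succ i ih =>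
    intro hi
    have h1 := ih (by omega)
    have h2 := hc i (by omega)
    push_cast
    linarith [dist_triangle (c (i + 1)) (c i) (c 0)]

theorem reachableIn_subset_cluster {t : ℝ} (ht : 0 ≤ t) (x : E d) (k : ℕ) :
    reachableIn X t x k ⊆ cluster X x (k * t) := by
  rintro y ⟨m, hm, c, rfl, rfl, hcX, hct⟩
  refine ⟨hcX m le_rfl, mem_closedBall.2 ((dist_chain_le hct m le_rfl).trans ?_)⟩
  gcongr

theorem image_reachableIn_subset {t : ℝ} (ht : 0 ≤ t) {g : E d ≃ᵢ E d} {x x' : E d} {ρ : ℝ}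
    (hx : g x = x') (hg : g '' cluster X x ρ = cluster X x' ρ) {k : ℕ} (hk : k * t ≤ ρ) :
    g '' reachableIn X t x k ⊆ reachableIn X t x' k := by
  rintro _ ⟨y, ⟨m, hm, c, rfl, rfl, hcX, hct⟩, rfl⟩
  refine ⟨m, hm, fun i => g (c i), hx, rfl, fun i hi => ?_, fun i hi => ?_⟩
  · have hmem : c i ∈ cluster X (c 0) ρ := by
      refine ⟨hcX i hi, mem_closedBall.2 ((dist_chain_le hct i hi).trans (le_trans ?_ hk))⟩
      gcongr
      omega
    exact (hg ▸ Set.mem_image_of_mem g hmem : g (c i) ∈ cluster X x' ρ).1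
  · simpa only [g.dist_eq] using hct i hi

theorem finrank_vectorSpan_image (g : E d ≃ᵢ E d) (s : Set (E d)) :
    finrank ℝ (vectorSpan ℝ (g '' s)) = finrank ℝ (vectorSpan ℝ s) := by
  have h := AffineMap.map_vectorSpan
    (g.toRealAffineIsometryEquiv.toAffineEquiv : E d →ᵃ[ℝ] E d) (s := s)
  have hcoe : ((g.toRealAffineIsometryEquiv.toAffineEquiv : E d →ᵃ[ℝ] E d) : E d → E d) = g := by
    ext1 x
    simp
  rw [hcoe] at h
  rw [← h]
  exact LinearEquiv.finrank_map_eq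
    (g.toRealAffineIsometryEquiv.toAffineEquiv.linear : E d ≃ₗ[ℝ] E d) _

/-- Chains of `k` steps stay inside the `ρ`-cluster, so cluster equivalences carry them to chains.
Swapping `x` and `x'` gives equality. -/
theorem IsClusterIsometric.finrank_reachableIn_le {ρ t : ℝ} (hX : IsClusterIsometric X ρ)
    (ht : 0 ≤ t) {k : ℕ} (hk : k * t ≤ ρ) {x x' : E d} (hx : x ∈ X) (hx' : x' ∈ X) :
    finrank ℝ (vectorSpan ℝ (reachableIn X t x k)) ≤
      finrank ℝ (vectorSpan ℝ (reachableIn X t x' k)) := by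
  obtain ⟨g, hgx, hg⟩ := hX x hx x' hx'
  rw [← finrank_vectorSpan_image g]
  exact Submodule.finrank_mono (vectorSpan_mono ℝ (image_reachableIn_subset ht hgx hg hk))

/-- If the span of the points reachable in `k` steps does not grow in the next step, then it
contains all reachable points. -/
theorem IsClusterIsometric.vectorSpan_reachableIn_eq_top {ρ t : ℝ} (hX : IsClusterIsometric X ρ)
    (ht : 0 ≤ t) {k : ℕ} (hk : (k + 1 : ℕ) * t ≤ ρ) {x : E d} (hx : x ∈ X)
    (hfull : FullDimensional (reachable X t x))
    (hstat : finrank ℝ (vectorSpan ℝ (reachableIn X t x (k + 1))) ≤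
      finrank ℝ (vectorSpan ℝ (reachableIn X t x k))) :
    vectorSpan ℝ (reachableIn X t x k) = ⊤ := by
  have hk' : k * t ≤ ρ := le_trans (by gcongr; omega) hk
  have hstep (y : E d) (hy : y ∈ X) : vectorSpan ℝ (reachableIn X t y k) =
      vectorSpan ℝ (reachableIn X t y (k + 1)) :=
    Submodule.eq_of_le_of_finrank_le (vectorSpan_mono ℝ (reachableIn_mono t y (Nat.le_succ k)))
      ((hX.finrank_reachableIn_le ht hk hy hx).trans
        (hstat.trans (hX.finrank_reachableIn_le ht hk' hx hy)))
  -- The `k`-step span at a neighbor lies in the `(k + 1)`-step span at `y`, which has stopped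
  -- growing; equal dimensions make the spans equal. The span is therefore constant along chains.
  have hadj (y z : E d) (hy : y ∈ X) (hz : z ∈ X) (hzy : dist z y ≤ t) :
      vectorSpan ℝ (reachableIn X t z k) = vectorSpan ℝ (reachableIn X t y k) :=
    Submodule.eq_of_le_of_finrank_le
      (by rw [hstep y hy]; exact vectorSpan_mono ℝ (reachableIn_subset_succ hy hzy k))
      (hX.finrank_reachableIn_le ht hk' hy hz)
  rw [FullDimensional] at hfull
  have hxr : x ∈ reachable X t x := Set.mem_iUnion.2 ⟨0, mem_reachableIn_self hx t 0⟩
  rw [eq_top_iff, ← AffineSubspace.direction_top ℝ (E d) (E d), ← hfull, direction_affineSpan,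
    vectorSpan_eq_span_vsub_set_right ℝ hxr, Submodule.span_le]
  rintro _ ⟨y, hy, rfl⟩
  obtain ⟨l, m, -, c, rfl, rfl, hcX, hct⟩ := Set.mem_iUnion.1 hy
  suffices ∀ i ≤ m, vectorSpan ℝ (reachableIn X t (c i) k) =
      vectorSpan ℝ (reachableIn X t (c 0) k) ∧
      c i - c 0 ∈ vectorSpan ℝ (reachableIn X t (c 0) k) from (this m le_rfl).2
  intro i
  induction i with
  | zero => simp
  | succ i ih =>
    intro hi
    obtain ⟨ih1, ih2⟩ := ih (by omega)
    have hci := hcX i (by omega)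
    have hci' := hcX (i + 1) hi
    have hdist := hct i (by omega)
    refine ⟨(hadj _ _ hci hci' hdist).trans ih1, ?_⟩
    rw [← sub_add_sub_cancel (c (i + 1)) (c i) (c 0)]
    refine Submodule.add_mem _ ?_ ih2
    rw [← ih1, hstep _ hci]
    exact vsub_mem_vectorSpan ℝ
      (reachableIn_mono t _ (by omega) (mem_reachableIn_one hci hci' hdist))
      (mem_reachableIn_self hci t _)

/-- The dimension gains at least one per step until it is full, so `d` steps suffice, and these stay
within distance `d * t`. -/
theorem IsClusterIsometric.vectorSpan_cluster {ρ t : ℝ} (hX : IsClusterIsometric X ρ)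
    (ht : 0 ≤ t) (hd : d * t ≤ ρ) {x : E d} (hx : x ∈ X)
    (hfull : FullDimensional (reachable X t x)) :
    vectorSpan ℝ (cluster X x (d * t)) = ⊤ := by
  have hrank : ∀ k ≤ d, k ≤ finrank ℝ (vectorSpan ℝ (reachableIn X t x k)) := by
    intro k
    induction k with
    | zero => simp
    | succ k ih =>
      intro hk
      have ih := ih (by omega)
      by_contra! hlt
      have hkρ : (k + 1 : ℕ) * t ≤ ρ := le_trans (by gcongr) hd
      have htop := hX.vectorSpan_reachableIn_eq_top ht hkρ hx hfull (by omega)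
      have hle := Submodule.finrank_mono
        (vectorSpan_mono ℝ (reachableIn_mono (X := X) t x (k.le_add_right 1)))
      rw [htop, finrank_top, finrank_euclideanSpace_fin] at hle
      omega
  apply Submodule.eq_top_of_finrank_eq
  apply le_antisymm (Submodule.finrank_le _)
  rw [finrank_euclideanSpace_fin]
  exact (hrank d le_rfl).trans
    (Submodule.finrank_mono (vectorSpan_mono ℝ (reachableIn_subset_cluster ht x d)))

/-! ### Cluster groups and their orders -/

theorem image_trans_isometryEquiv (g h : E d ≃ᵢ E d) (s : Set (E d)) :
    g.trans h '' s = h '' (g '' s) := by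
  rw [← Set.image_comp]
  rfl

/-- The group of isometries that fix `x` and preserve the `ρ`-cluster at `x`. -/
def clusterGroup (X : Set (E d)) (x : E d) (ρ : ℝ) : Subgroup (E d ≃ᵢ E d) where
  carrier := {g | g x = x ∧ g '' cluster X x ρ = cluster X x ρ}
  one_mem' := by simp
  mul_mem' := by
    rintro g h ⟨hg, hg'⟩ ⟨hh, hh'⟩
    refine ⟨by simp [hg, hh], ?_⟩
    rw [IsometryEquiv.coe_mul, Set.image_comp, hh', hg']
  inv_mem' := by
    rintro g ⟨hg, hg'⟩
    refine ⟨g.symm_apply_eq.2 hg.symm, ?_⟩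
    conv_lhs => rw [← hg', ← Set.image_comp]
    change (g.symm ∘ g) '' _ = _
    simp

theorem mem_clusterGroup {x : E d} {ρ : ℝ} {g : E d ≃ᵢ E d} :
    g ∈ clusterGroup X x ρ ↔ g x = x ∧ g '' cluster X x ρ = cluster X x ρ := Iff.rfl

theorem clusterGroup_anti (x : E d) {ρ σ : ℝ} (h : ρ ≤ σ) :
    clusterGroup X x σ ≤ clusterGroup X x ρ := by
  rintro g ⟨hg, hg'⟩
  have := image_cluster_inter_closedBall hg' hg (z := x) (ρ := ρ) (by simpa using h)
  rw [hg] at this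
  exact ⟨hg, this⟩

/-- Two isometries that agree at `x` and at points whose differences with `x` span the space are
equal. -/
theorem isometryEquiv_eq_of_eqOn {g h : E d ≃ᵢ E d} {x : E d} {ι : Type*} {p : ι → E d}
    (hp : Submodule.span ℝ (Set.range fun i => p i - x) = ⊤) (hx : g x = h x)
    (hgh : ∀ i, g (p i) = h (p i)) : g = h := by
  have hlin : g.toRealAffineIsometryEquiv.linearIsometryEquiv.toLinearEquiv.toLinearMap =
      h.toRealAffineIsometryEquiv.linearIsometryEquiv.toLinearEquiv.toLinearMap := by
    apply LinearMap.ext_on_range hp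
    intro i
    have hg' := g.toRealAffineIsometryEquiv.map_vsub (p i) x
    have hh' := h.toRealAffineIsometryEquiv.map_vsub (p i) x
    simp only [IsometryEquiv.coeFn_toRealAffineIsometryEquiv, vsub_eq_sub] at hg' hh'
    simp only [LinearEquiv.coe_coe, LinearIsometryEquiv.coe_toLinearEquiv, hg', hh', hx, hgh]
  ext1 y
  have hy := LinearMap.congr_fun hlin (y - x)
  have hg' := g.toRealAffineIsometryEquiv.map_vsub y x
  have hh' := h.toRealAffineIsometryEquiv.map_vsub y x
  simp only [IsometryEquiv.coeFn_toRealAffineIsometryEquiv, vsub_eq_sub] at hg' hh'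
  simp only [LinearEquiv.coe_coe, LinearIsometryEquiv.coe_toLinearEquiv, hg', hh', hx] at hy
  exact sub_left_injective hy

/-- A cluster group is finite, of order at most the `d`-th power of the size of the cluster, once
the cluster is full-dimensional. -/
theorem card_clusterGroup_le {x : E d} {ρ : ℝ} (hx : x ∈ cluster X x ρ)
    (hfin : (cluster X x ρ).Finite) (hspan : vectorSpan ℝ (cluster X x ρ) = ⊤) :
    Finite (clusterGroup X x ρ) ∧
      Nat.card (clusterGroup X x ρ) ≤ (cluster X x ρ).ncard ^ d := by
  have := hfin.to_subtype
  rw [vectorSpan_eq_span_vsub_set_right ℝ hx] at hspan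
  obtain ⟨f, hfs, hf, -⟩ := Submodule.exists_fun_fin_finrank_span_eq ℝ
    ((fun y => y -ᵥ x) '' cluster X x ρ)
  choose p hp hpf using hfs
  obtain rfl : (fun i => p i - x) = f := funext hpf
  replace hf := hf.trans hspan
  let φ : clusterGroup X x ρ →
      (Fin (finrank ℝ (Submodule.span ℝ ((fun y => y -ᵥ x) '' cluster X x ρ))) →
        cluster X x ρ) :=
    fun g i => ⟨g.1 (p i), g.2.2 ▸ Set.mem_image_of_mem g.1 (hp i)⟩
  have hφ : Function.Injective φ := by
    intro g h hgh
    apply Subtype.ext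
    exact isometryEquiv_eq_of_eqOn hf (g.2.1.trans h.2.1.symm)
      fun i => congrArg Subtype.val (congrFun hgh i)
  refine ⟨Finite.of_injective φ hφ, (Nat.card_le_card_of_injective φ hφ).trans_eq ?_⟩
  rw [Nat.card_fun, Nat.card_coe_set_eq, Nat.card_fin, hspan, finrank_top,
    finrank_euclideanSpace_fin]

/-- An antitone sequence of subgroups of a finite group of order less than `2 ^ n` has a
repetition among the first `n` steps. -/
theorem exists_eq_succ_of_antitone {G : Type*} [Group G] {S : ℕ → Subgroup G} (hS : Antitone S)
    (hfin : Finite (S 0)) {n : ℕ} (hn : Nat.card (S 0) < 2 ^ n) : ∃ j < n, S j = S (j + 1) := by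
  by_contra! hne
  have hfin' (j : ℕ) : Finite (S j) :=
    Finite.of_injective _ (Subgroup.inclusion_injective (hS (Nat.zero_le j)))
  have key : ∀ j ≤ n, 2 ^ j * Nat.card (S j) ≤ Nat.card (S 0) := by
    intro j
    induction j with
    | zero => simp
    | succ j ih =>
      intro hj
      have hle : S (j + 1) ≤ S j := hS (Nat.le_succ j)
      obtain ⟨c, hc⟩ := Subgroup.card_dvd_of_le hle
      have hfj := hfin' j
      have hpos : 0 < Nat.card (S j) := Nat.card_pos
      -- The index `c` is nonzero because the order is positive, and is not `1` because the
      -- inclusion is strict.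
      have hc2 : 2 ≤ c := by
        by_contra! hlt
        interval_cases c
        · omega
        · exact hne j (by omega) (Subgroup.eq_of_le_of_card_ge hle (by omega)).symm
      calc 2 ^ (j + 1) * Nat.card (S (j + 1)) = 2 ^ j * (Nat.card (S (j + 1)) * 2) := by ring
        _ ≤ 2 ^ j * Nat.card (S j) := by rw [hc]; gcongr
        _ ≤ _ := ih (by omega)
  have hfn := hfin' n
  have hpos : 0 < Nat.card (S n) := Nat.card_pos
  have := key n le_rfl
  nlinarith [Nat.pos_of_ne_zero (pow_ne_zero n (two_ne_zero : (2 : ℕ) ≠ 0))]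

/-- Conjugating by an equivalence of the `σ`-clusters identifies the cluster groups at `x` and `y`
for both radii, so stabilization at one point spreads to all. -/
theorem IsClusterIsometric.clusterGroup_le {ρ σ : ℝ} (hρσ : ρ ≤ σ) (hX : IsClusterIsometric X σ)
    {x : E d} (hx : x ∈ X) (hS : clusterGroup X x ρ ≤ clusterGroup X x σ) {y : E d} (hy : y ∈ X) :
    clusterGroup X y ρ ≤ clusterGroup X y σ := by
  rintro k ⟨hky, hk⟩
  obtain ⟨h, hh, hhσ⟩ := hX x hx y hy
  have hhρ : h '' cluster X x ρ = cluster X y ρ := by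
    rw [image_cluster_inter_closedBall hhσ hh (by simpa using hρσ), hh]
  have hsymm {τ : ℝ} (hτ : h '' cluster X x τ = cluster X y τ) :
      h.symm '' cluster X y τ = cluster X x τ := by
    rw [← hτ, ← Set.image_comp]
    simp
  have hmem : h.trans (k.trans h.symm) ∈ clusterGroup X x ρ := by
    refine ⟨h.symm_apply_eq.2 ((congrArg k hh).trans (hky.trans hh.symm)), ?_⟩
    rw [image_trans_isometryEquiv, image_trans_isometryEquiv, hhρ, hk,
      hsymm hhρ]
  obtain ⟨-, h2⟩ := hS hmem
  refine ⟨hky, ?_⟩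
  rw [image_trans_isometryEquiv, image_trans_isometryEquiv, hhσ] at h2
  exact h.symm.injective.image_injective (h2.trans (hsymm hhσ).symm)

/-! ### The local criterion -/

namespace IsDelone

/-- If the cluster groups at radii `ρ` and `ρ + 2R` coincide, then an isometry matching two
clusters of radius `ρ + 2R` maps `X` into itself. -/
theorem image_subset (hX : IsDelone X r R) {ρ : ℝ} (hρ : 0 ≤ ρ)
    (hiso : IsClusterIsometric X (ρ + 2 * R))
    (hS : ∀ y ∈ X, clusterGroup X y ρ ≤ clusterGroup X y (ρ + 2 * R)) {g : E d ≃ᵢ E d}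
    {x : E d} (hx : x ∈ X) (hgx : g x ∈ X)
    (hg : g '' cluster X x (ρ + 2 * R) = cluster X (g x) (ρ + 2 * R)) : g '' X ⊆ X := by
  have hR := hX.covering_pos
  suffices ∀ z ∈ X, g z ∈ X ∧ g '' cluster X z (ρ + 2 * R) = cluster X (g z) (ρ + 2 * R) by
    rintro _ ⟨z, hz, rfl⟩
    exact (this z hz).1
  refine hX.chain_induction hx ⟨hgx, hg⟩ ?_
  rintro y hy z hz hzy ⟨-, hgy⟩
  have hgz : g z ∈ X := by
    have hz' : z ∈ cluster X y (ρ + 2 * R) := ⟨hz, mem_closedBall.2 (by linarith)⟩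
    exact (hgy ▸ Set.mem_image_of_mem g hz' : g z ∈ cluster X (g y) (ρ + 2 * R)).1
  have hgρ : g '' cluster X z ρ = cluster X (g z) ρ :=
    image_cluster_inter_closedBall hgy rfl (by linarith)
  -- Moving to `z` costs `2R` of the matched radius. To regain it, return to `z` by a full
  -- equivalence `h`: the composite is in the group at radius `ρ`, hence at `ρ + 2R`, and `h` can be
  -- cancelled.
  obtain ⟨h, hh, hhσ⟩ := hiso (g z) hgz z hz
  have hhρ : h '' cluster X (g z) ρ = cluster X z ρ := by
    rw [image_cluster_inter_closedBall hhσ hh (by simp; linarith), hh]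
  have hmem : g.trans h ∈ clusterGroup X z ρ :=
    ⟨hh, by rw [image_trans_isometryEquiv, hgρ, hhρ]⟩
  obtain ⟨-, h2⟩ := hS z hz hmem
  rw [image_trans_isometryEquiv] at h2
  exact ⟨hgz, h.injective.image_injective (h2.trans hhσ.symm)⟩

/-- The local criterion for regular systems. -/
theorem isRegularSystem (hX : IsDelone X r R) {ρ : ℝ} (hρ : 0 ≤ ρ)
    (hiso : IsClusterIsometric X (ρ + 2 * R)) {x₀ : E d} (hx₀ : x₀ ∈ X)
    (hS : clusterGroup X x₀ ρ ≤ clusterGroup X x₀ (ρ + 2 * R)) : IsRegularSystem X := by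
  have hR := hX.covering_pos
  have hS' (y : E d) (hy : y ∈ X) : clusterGroup X y ρ ≤ clusterGroup X y (ρ + 2 * R) :=
    hiso.clusterGroup_le (by linarith) hx₀ hS hy
  intro x hx x' hx'
  obtain ⟨g, rfl, hg⟩ := hiso x hx x' hx'
  refine ⟨g, rfl, (hX.image_subset hρ hiso hS' hx hx' hg).antisymm ?_⟩
  have hsymm : g.symm '' X ⊆ X := by
    refine hX.image_subset hρ hiso hS' hx' (by simpa using hx) ?_
    rw [g.symm_apply_apply, ← hg, ← Set.image_comp]
    simp
  intro y hy
  exact ⟨g.symm y, hsymm (Set.mem_image_of_mem _ hy), g.apply_symm_apply y⟩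

/-- If the order of the cluster group at radius `2R` is less than `2 ^ n`, then being
`2R(n + 1)`-isometric forces regularity. -/
theorem isRegularSystem_of_card_lt (hX : IsDelone X r R) {n : ℕ} {x : E d} (hx : x ∈ X)
    (hfin : Finite (clusterGroup X x (2 * R)))
    (hcard : Nat.card (clusterGroup X x (2 * R)) < 2 ^ n)
    (hiso : IsClusterIsometric X (2 * R * (n + 1))) : IsRegularSystem X := by
  have hR := hX.covering_pos
  -- `S 0` belongs to radius `2R`; a repetition at `j < n` involves radii up to `2R(j + 2) ≤ 2R(n +
  -- 1)`.
  let S : ℕ → Subgroup (E d ≃ᵢ E d) := fun j => clusterGroup X x (2 * R * (j + 1))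
  have hanti : Antitone S := fun i j hij => clusterGroup_anti x (by gcongr)
  have h0 : S 0 = clusterGroup X x (2 * R) := by simp [S]
  obtain ⟨j, hj, hjS⟩ := exists_eq_succ_of_antitone hanti (h0 ▸ hfin) (by rwa [h0])
  have hrad : 2 * R * ((j : ℝ) + 1) + 2 * R = 2 * R * ((j + 1 : ℕ) + 1) := by push_cast; ring
  refine hX.isRegularSystem (ρ := 2 * R * (j + 1)) (by positivity) ?_ hx ?_
  · rw [hrad]
    exact hiso.mono (by gcongr; omega)
  · rw [hrad]
    exact hjS.le

end IsDelone

/-! ### Group order in the reachable family and the final bounds -/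

/-- Some cluster with radius at most `2R` is full-dimensional and has at most `(2da+1)^d` points,
which bounds the order of the cluster group. -/
theorem card_clusterGroup_le_of_mem_reachableFamily {a : ℝ} (ha : 0 ≤ a)
    (hX : X ∈ reachableFamily d a r R) {x : E d} (hx : x ∈ X) :
    Finite (clusterGroup X x (2 * R)) ∧
      (Nat.card (clusterGroup X x (2 * R)) : ℝ) ≤ (2 * d * a + 1) ^ (d ^ 2) := by
  obtain ⟨hD, hiso, hfull⟩ := hX
  have hr := hD.pos
  have hR := hD.covering_pos
  -- Take the smaller of `2dar` and `2R`: being at most `2R` makes the group at `2R` a subgroup of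
  -- the one at `ρ`, and being at most `2dar` bounds the number of points.
  obtain ⟨ρ, hρ0, hρR, hρa, hspan⟩ : ∃ ρ, 0 ≤ ρ ∧ ρ ≤ 2 * R ∧ ρ ≤ 2 * d * a * r ∧
      vectorSpan ℝ (cluster X x ρ) = ⊤ := by
    rcases le_or_gt (2 * d * a * r) (2 * R) with h | h
    · have heq : 2 * d * a * r = d * (2 * a * r) := by ring
      refine ⟨2 * d * a * r, by positivity, h, le_rfl, ?_⟩
      rw [heq] at h ⊢
      exact hiso.vectorSpan_cluster (by positivity) h hx (hfull x hx)
    · exact ⟨2 * R, by positivity, le_rfl, h.le, hD.vectorSpan_cluster hx⟩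
  obtain ⟨hfin, hcard⟩ := card_clusterGroup_le (mem_cluster_self hx hρ0)
    (hD.packs.finite_cluster hr x ρ) hspan
  have hle : clusterGroup X x (2 * R) ≤ clusterGroup X x ρ := clusterGroup_anti x hρR
  refine ⟨Finite.of_injective _ (Subgroup.inclusion_injective hle), ?_⟩
  have hnat := (Nat.card_le_card_of_injective _ (Subgroup.inclusion_injective hle)).trans hcard
  calc (Nat.card (clusterGroup X x (2 * R)) : ℝ) ≤ ((cluster X x ρ).ncard : ℝ) ^ d := by
        exact_mod_cast hnat
    _ ≤ ((ρ / r + 1) ^ d) ^ d := by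
        gcongr
        exact hD.packs.ncard_cluster_le hr x hρ0
    _ ≤ ((2 * d * a + 1) ^ d) ^ d := by
        gcongr
        rwa [div_le_iff₀ hr]
    _ = (2 * d * a + 1) ^ (d ^ 2) := by rw [← pow_mul, sq]

theorem forcesRegularity_reachableFamily {a : ℝ} (ha : 0 ≤ a) :
    ForcesRegularity (reachableFamily d a r R)
      ((4 + 2 * (d : ℝ) ^ 2 * Real.logb 2 (2 * d * a + 1)) * R) := by
  intro X hX hiso
  have hD := hX.1
  have hR := hD.covering_pos
  obtain ⟨x, hx, -⟩ := hD.covers 0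
  obtain ⟨hfin, hcard⟩ := card_clusterGroup_le_of_mem_reachableFamily ha hX hx
  have hone : 1 ≤ 2 * d * a + 1 := le_add_of_nonneg_left (by positivity)
  set L : ℝ := (d : ℝ) ^ 2 * Real.logb 2 (2 * d * a + 1) with hL
  have hL0 : 0 ≤ L := mul_nonneg (by positivity) (Real.logb_nonneg one_lt_two hone)
  have hpow : (2 * d * a + 1) ^ (d ^ 2) = (2 : ℝ) ^ L := by
    rw [hL, mul_comm ((d : ℝ) ^ 2), Real.rpow_mul two_pos.le, Real.rpow_logb two_pos (by norm_num) (by linarith)]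
    exact_mod_cast rfl
  -- The least `n` with `2 ^ L < 2 ^ n`; the required radius `2R(⌊L⌋ + 2)` is at most `(4 + 2L)R`.
  refine hD.isRegularSystem_of_card_lt (n := ⌊L⌋₊ + 1) hx hfin ?_ (hiso.mono ?_)
  · have hlt : (2 : ℝ) ^ L < 2 ^ (⌊L⌋₊ + 1) := by
      rw [← Real.rpow_natCast]
      apply Real.rpow_lt_rpow_of_exponent_lt one_lt_two
      exact_mod_cast Nat.lt_floor_add_one L
    exact_mod_cast (hcard.trans_eq hpow).trans_lt hlt
  · have := Nat.floor_le hL0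
    push_cast
    nlinarith

end DeloneRegularity

open DeloneRegularity in
theorem theorem4p2 (a : ℝ) (ha : 1 ≤ a) :
    (∃ C : ℝ, 0 < C ∧ ∀ d : ℕ, 2 ≤ d → ∀ r R : ℝ, 0 < r → r ≤ R →
      RegularityRadiusAtMost (reachableFamily d a r R)
        (C * ((d : ℝ) ^ 2 * Real.logb 2 d) * R)) ∧
    (∀ d : ℕ, 1 ≤ d → ∀ r R : ℝ, 0 < r → r ≤ R →
      (2 * d * a * r ≤ 2 * R →
        RegularityRadiusAtMost (reachableFamily d a r R)
          ((4 + 2 * (d : ℝ) ^ 2 * Real.logb 2 (2 * d * a + 1)) * R)) ∧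
      (2 * R < 2 * d * a * r →
        RegularityRadiusAtMost (reachableFamily d a r R)
          (2 * R * ((d : ℝ) ^ 2 + 1) * Real.logb 2 (2 * d * a + 2)))) := by
  have hmain (d : ℕ) (r R : ℝ) := forcesRegularity_reachableFamily (d := d) (r := r) (R := R)
    (zero_le_one.trans ha)
  have hlog0 (d : ℕ) : 0 ≤ Real.logb 2 (2 * d * a + 1) :=
    Real.logb_nonneg one_lt_two (le_add_of_nonneg_left (by positivity))
  have hpos (d : ℕ) (R : ℝ) (hR : 0 < R) :
      0 < (4 + 2 * (d : ℝ) ^ 2 * Real.logb 2 (2 * d * a + 1)) * R := by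
    have := hlog0 d
    positivity
  have hle (d : ℕ) (hd : 1 ≤ d) (R : ℝ) (hR : 0 < R) :
      (4 + 2 * (d : ℝ) ^ 2 * Real.logb 2 (2 * d * a + 1)) * R ≤
        2 * R * ((d : ℝ) ^ 2 + 1) * Real.logb 2 (2 * d * a + 2) := by
    have hd' : (1 : ℝ) ≤ d := by exact_mod_cast hd
    have hda : 1 ≤ d * a := one_le_mul_of_one_le_of_one_le hd' ha
    -- From `da ≥ 1`, the argument is at least `4`. The extra summand `2R log(2da + 2)` then absorbs
    -- `4R`.
    have h2 : 2 ≤ Real.logb 2 (2 * d * a + 2) := by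
      rw [Real.le_logb_iff_rpow_le one_lt_two (by linarith)]
      norm_num
      linarith
    have hmono : Real.logb 2 (2 * d * a + 1) ≤ Real.logb 2 (2 * d * a + 2) :=
      Real.logb_le_logb_of_le one_lt_two (by linarith) (by linarith)
    have := mul_le_mul_of_nonneg_left hmono (sq_nonneg (d : ℝ))
    nlinarith
  -- The constant combines `d ^ 2 + 1 ≤ 2 d ^ 2` with `log(2da + 2) ≤ log(4da) = 2 + log d + log a ≤
  -- (3 + log a) log d`, where `log d ≥ 1`.
  refine ⟨⟨4 * (3 + Real.logb 2 a), ?_, fun d hd r R hr hrR => ?_⟩, fun d hd r R hr hrR =>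
    ⟨fun _ => (hmain d r R).regularityRadiusAtMost (hpos d R (hr.trans_le hrR)), fun _ => ?_⟩⟩
  · have := Real.logb_nonneg one_lt_two ha
    positivity
  · have hR := hr.trans_le hrR
    have hd' : (2 : ℝ) ≤ d := by exact_mod_cast hd
    have hda : 1 ≤ d * a := one_le_mul_of_one_le_of_one_le (by linarith) ha
    have hloga := Real.logb_nonneg one_lt_two ha
    have hlogd : 1 ≤ Real.logb 2 d := by
      rw [Real.le_logb_iff_rpow_le one_lt_two (by linarith)]
      simpa using hd'
    have hlog : Real.logb 2 (2 * d * a + 2) ≤ (3 + Real.logb 2 a) * Real.logb 2 d := by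
      have h4 : Real.logb 2 4 = 2 := by
        rw [Real.logb_eq_iff_rpow_eq two_pos (by norm_num) (by norm_num)]
        norm_num
      calc Real.logb 2 (2 * d * a + 2) ≤ Real.logb 2 (4 * (d * a)) :=
            Real.logb_le_logb_of_le one_lt_two (by linarith) (by linarith)
        _ = 2 + (Real.logb 2 d + Real.logb 2 a) := by
            rw [Real.logb_mul (by norm_num) (by linarith), Real.logb_mul (by linarith) (by linarith),
              h4]
        _ ≤ (3 + Real.logb 2 a) * Real.logb 2 d := by nlinarith
    have hle' : 2 * R * ((d : ℝ) ^ 2 + 1) * Real.logb 2 (2 * d * a + 2) ≤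
        4 * (3 + Real.logb 2 a) * ((d : ℝ) ^ 2 * Real.logb 2 d) * R :=
      calc _ ≤ 2 * R * ((d : ℝ) ^ 2 + d ^ 2) * ((3 + Real.logb 2 a) * Real.logb 2 d) := by
            have := (Real.logb_nonneg one_lt_two (by linarith) : 0 ≤ Real.logb 2 (2 * d * a + 2))
            gcongr
            nlinarith
        _ = _ := by ring
    have hB := (hle d (by omega) R hR).trans hle'
    exact ((hmain d r R).mono hB).regularityRadiusAtMost ((hpos d R hR).trans_le hB)
  · have hB := hle d hd R (hr.trans_le hrR)
    exact ((hmain d r R).mono hB).regularityRadiusAtMost ((hpos d R (hr.trans_le hrR)).trans_le hB)
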